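/- Germs are taken on right neighbourhoods of the origin. For $r\in\{1,\omega\}$, let $\mathrm{Diff}^r_+(\mathbb{R},0)$ be the group, under composition, of germs at $0$ of orientation-preserving $C^r$ diffeomorphisms fixing $0$ between intervals of the form $[0,\eta)$, $\eta>0$, where $C^\omega$ means real-analytic (up to and including the endpoint $0$) and two maps define the same germ if they coincide on some $[0,\eta')$, $\eta'>0$. A germ is parabolic if its derivative at $0$ equals $1$. An element $g$ of a group $G$ is a distortion element of $G$ if there is a finite set $S\subset G$ such that $g$ belongs to the subgroup generated by $S$ and $g^n$ is a product of at most $o(n)$ elements of $S\cup S^{-1}$ as $n\to\infty$. **Proposition.** Let $f\in \mathrm{Diff}^\omega_+(\mathbb{R},0)$ be parabolic and different from the identity. Then $f$ is a distortion element of $\mathrm{Diff}^1_+(\mathbb{R},0)$. Moreover, let $\ell\ge 1$ be the order of contact of $f$ with the identity, so that $f(x)=x+\sum_{n\ge \ell+1}a_nx^n$ with $c:=a_{\ell+1}\neq 0$. Then $f$ is conjugate, by an element of $\mathrm{Diff}^1_+(\mathbb{R},0)$, to the germ $$g(x)=\frac{x}{\bigl(1-\mathrm{sign}(c)\,x^{\ell}\bigr)^{1/\ell}},$$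 and $h\,g\,h^{-1}=g^2$ in $\mathrm{Diff}^1_+(\mathbb{R},0)$, where $h(x)=x/2^{1/\ell}$. -/

import Mathlib

open Set Filter Topology
open scoped ContDiff

/-- `F` restricts to a `C^r` map of some interval `[0, η)` into `[0, ∞)` that fixes `0`
(`r = ω` means real-analytic, up to and including the endpoint `0`).
The values of `F` outside `[0, η)` play no role. -/
def IsRightMap (r : WithTop ℕ∞) (F : ℝ → ℝ) : Prop :=
  F 0 = 0 ∧ ∃ η : ℝ, 0 < η ∧ (∀ x ∈ Ico 0 η, 0 ≤ F x) ∧ ContDiffOn ℝ r F (Ico 0 η)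

theorem IsRightMap.tendsto {r : WithTop ℕ∞} {F : ℝ → ℝ} (hF : IsRightMap r F) :
    Tendsto F (𝓝[≥] 0) (𝓝[≥] 0) := by
  obtain ⟨h0, η, hη, hpos, hC⟩ := hF
  have hmem : Ico (0 : ℝ) η ∈ 𝓝[≥] (0 : ℝ) := Ico_mem_nhdsGE hη
  refine tendsto_nhdsWithin_iff.2 ⟨?_, ?_⟩
  · have hc : ContinuousWithinAt F (Ico 0 η) 0 := hC.continuousOn 0 ⟨le_rfl, hη⟩
    have hc' : ContinuousWithinAt F (Ici 0) 0 := hc.mono_of_mem_nhdsWithin hmem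
    simpa [ContinuousWithinAt, h0] using hc'
  · filter_upwards [hmem] with x hx using hpos x hx

theorem IsRightMap.comp {r : WithTop ℕ∞} {F G : ℝ → ℝ} (hF : IsRightMap r F)
    (hG : IsRightMap r G) : IsRightMap r (F ∘ G) := by
  have hT := hG.tendsto
  obtain ⟨hF0, η, hη, hFpos, hFC⟩ := hF
  obtain ⟨hG0, θ, hθ, hGpos, hGC⟩ := hG
  have hev : ∀ᶠ x in 𝓝[≥] (0 : ℝ), x ∈ Ico 0 θ ∧ G x ∈ Ico 0 η :=
    inter_mem (Ico_mem_nhdsGE hθ) (hT (Ico_mem_nhdsGE hη))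
  obtain ⟨δ, hδ, hsub⟩ := (mem_nhdsGE_iff_exists_Ico_subset).1 hev
  refine ⟨by simp [hG0, hF0], δ, hδ, fun x hx => hFpos _ (hsub hx).2, ?_⟩
  exact hFC.comp (hGC.mono fun x hx => (hsub hx).1) fun x hx => (hsub hx).2

/-- The monoid, under composition, of the maps satisfying `IsRightMap r`. -/
def rightMaps (r : WithTop ℕ∞) : Submonoid (Function.End ℝ) where
  carrier := {F | IsRightMap r F}
  mul_mem' := fun hF hG => IsRightMap.comp hF hG
  one_mem' := ⟨rfl, 1, one_pos, fun _ hx => hx.1, contDiffOn_id⟩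

/-- Two maps have the same germ if they coincide on some interval `[0, η')`, `η' > 0`. -/
def germCon (r : WithTop ℕ∞) : Con (rightMaps r) where
  r F G := ∃ η' : ℝ, 0 < η' ∧ ∀ x ∈ Ico 0 η', F.1 x = G.1 x
  iseqv :=
    ⟨fun _ => ⟨1, one_pos, fun _ _ => rfl⟩,
     fun ⟨η, hη, h⟩ => ⟨η, hη, fun x hx => (h x hx).symm⟩,
     fun ⟨η, hη, h⟩ ⟨θ, hθ, k⟩ => ⟨min η θ, lt_min hη hθ, fun x hx =>
      (h x ⟨hx.1, hx.2.trans_le (min_le_left _ _)⟩).trans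
        (k x ⟨hx.1, hx.2.trans_le (min_le_right _ _)⟩)⟩⟩
  mul' := by
    rintro F F' G G' ⟨η, hη, h⟩ ⟨θ, hθ, k⟩
    have hev : ∀ᶠ x in 𝓝[≥] (0 : ℝ), x ∈ Ico 0 θ ∧ G.1 x ∈ Ico 0 η :=
      inter_mem (Ico_mem_nhdsGE hθ) (IsRightMap.tendsto G.2 (Ico_mem_nhdsGE hη))
    obtain ⟨δ, hδ, hsub⟩ := (mem_nhdsGE_iff_exists_Ico_subset).1 hev
    refine ⟨δ, hδ, fun x hx => ?_⟩
    change F.1 (G.1 x) = F'.1 (G'.1 x)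
    rw [← k x (hsub hx).1, h _ (hsub hx).2]

/-- The germ of a map satisfying `IsRightMap r`. -/
def rightGerm {r : WithTop ℕ∞} {F : ℝ → ℝ} (hF : IsRightMap r F) : (germCon r).Quotient :=
  (germCon r).mk' (⟨F, hF⟩ : rightMaps r)

/-- The group `Diff^r_+(ℝ, 0)` of germs at `0`, on right neighbourhoods `[0, η)`, of
(orientation-preserving) `C^r` diffeomorphisms fixing `0`, under composition: the germs of `C^r`
maps that admit a `C^r` inverse germ. -/
abbrev DiffGerm (r : WithTop ℕ∞) : Type := ((germCon r).Quotient)ˣ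

namespace DiffGerm

/-- The germ `f` is the germ of the map `F`. -/
def IsGermOf {r : WithTop ℕ∞} (f : DiffGerm r) (F : ℝ → ℝ) : Prop :=
  ∃ hF : IsRightMap r F, (f : (germCon r).Quotient) = rightGerm hF

/-- The natural homomorphism `Diff^r_+(ℝ, 0) → Diff^s_+(ℝ, 0)` for `s ≤ r`: the same germ, viewed
with less regularity. -/
def ofLE {r s : WithTop ℕ∞} (h : s ≤ r) : DiffGerm r →* DiffGerm s :=
  Units.map ((germCon r).lift
    ((germCon s).mk'.comp (Submonoid.inclusion (S := rightMaps r) (T := rightMaps s)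
      fun _ ⟨h0, η, hη, hp, hC⟩ => ⟨h0, η, hη, hp, hC.of_le h⟩))
    (fun _ _ hFG => (Con.eq (germCon s)).2 hFG))

/-- A germ is parabolic if its (right) derivative at `0` equals `1`. -/
def IsParabolic {r : WithTop ℕ∞} (f : DiffGerm r) : Prop :=
  ∃ F : ℝ → ℝ, f.IsGermOf F ∧ HasDerivWithinAt F 1 (Ici 0) 0

/-- The analytic germ `f` has a convergent expansion `f(x) = x + ∑_{n ≥ ℓ+1} a_n x^n` with
`a_{ℓ+1} = c ≠ 0`; that is, `f` is exactly `ℓ`-tangent to the identity, with leading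
coefficient `c`. -/
def IsExactlyTangent (f : DiffGerm ω) (ℓ : ℕ) (c : ℝ) : Prop :=
  c ≠ 0 ∧ ∃ F : ℝ → ℝ, f.IsGermOf F ∧ ∃ a : ℕ → ℝ, a (ℓ + 1) = c ∧
    ∀ᶠ x in 𝓝[≥] (0 : ℝ), HasSum (fun n : ℕ => a (ℓ + 1 + n) * x ^ (ℓ + 1 + n)) (F x - x)

end DiffGerm

/-- `x` is a product of at most `k` factors taken among the elements of `S` and their inverses. -/
def IsProductOfAtMost {G : Type*} [Group G] (S : Set G) (k : ℕ) (x : G) : Prop :=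
  ∃ l : List G, l.length ≤ k ∧ (∀ s ∈ l, s ∈ S ∨ s⁻¹ ∈ S) ∧ l.prod = x

/-- `g` is a distortion element of the group `G` if it lies in a subgroup generated by a finite
set `S` and `g ^ n` is a product of at most `o(n)` factors among the elements of `S` and their
inverses. -/
def IsDistortionElement {G : Type*} [Group G] (g : G) : Prop :=
  ∃ S : Set G, S.Finite ∧ g ∈ Subgroup.closure S ∧
    ∃ k : ℕ → ℕ, (fun n => (k n : ℝ)) =o[atTop] (fun n => (n : ℝ)) ∧
      ∀ n : ℕ, IsProductOfAtMost S (k n) (g ^ n)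

/-! Everything is read in the coordinate `y = x ^ (-ℓ)`, which sends `0⁺` to `+∞`. There `g` is the
translation `y ↦ y - sign c` and `h` is `y ↦ 2 * y`, so `h * g * h⁻¹ = g ^ 2`. This relation makes
`g ^ n` a word of length `O(log n)`, and distortion passes to conjugates, so it remains to conjugate
`f` to `g`. Write `f(x) = x + x ^ (ℓ + 1) * k(x)` with `k 0 = c ≠ 0`. At infinity `f` becomes a map
`T` with `T y - y → a = -ℓ c` and `T' y - 1 = O(y ^ (-1 - 1/ℓ))`. If `c < 0`, orbits go to `+∞` at
linear speed, so `∏ T' (T^[k] y)` converges; `a⁻¹` times this product is the derivative of a `C^1`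
solution of Abel's equation `Φ ∘ T = Φ + 1` (`exists_abel_function`). Since `Φ' → a⁻¹ > 0`, the map
`x ↦ Φ (x ^ (-ℓ)) ^ (-1/ℓ)` is a `C^1` diffeomorphism up to the endpoint `0`, and it conjugates `f`
to `g` (`DiffGerm.exists_conj_rootModel`). If `c > 0`, the argument is applied to `f⁻¹`, which has
the same `ℓ` and leading coefficient `-c` (`DiffGerm.expansion_inv`). -/

/-! ### Distortion from the relation `h * g * h⁻¹ = g ^ 2`. -/

/-- Horner's scheme in base 2: `g ^ (2 * n + b) = h * g ^ n * h⁻¹ * g ^ b`, so each binary digit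
costs at most three letters. -/
theorem isProductOfAtMost_pow_of_conj_eq_sq {G : Type*} [Group G] {g h : G}
    (hgh : h * g * h⁻¹ = g ^ 2) (n : ℕ) :
    IsProductOfAtMost {g, h} (3 * Nat.size n) (g ^ n) := by
  induction n using Nat.binaryRec' with
  | zero => exact ⟨[], by simp, by simp, by simp⟩
  | bit b n hn ih =>
    obtain ⟨l, hl, hlS, hlp⟩ := ih
    -- `hn` forbids a leading digit `0`, the only case in which the size would not grow.
    have hsize : (Nat.bit b n).size = n.size + 1 := by
      apply Nat.size_bit
      intro h0
      rw [Nat.bit_eq_zero_iff] at h0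
      simp [hn h0.1] at h0
    have hpow : h * g ^ n * h⁻¹ = g ^ (2 * n) := by rw [← conj_pow, hgh, pow_mul]
    rw [hsize]
    cases b with
    | false =>
      refine ⟨h :: (l ++ [h⁻¹]), by simp; omega, ?_, ?_⟩
      · intro s hs
        simp only [List.mem_cons, List.mem_append, List.not_mem_nil, or_false] at hs
        rcases hs with rfl | hs | rfl
        · simp
        · exact hlS s hs
        · simp
      · simp [hlp, ← mul_assoc, hpow, Nat.bit]
    | true =>
      refine ⟨h :: (l ++ [h⁻¹, g]), by simp; omega, ?_, ?_⟩
      · intro s hs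
        simp only [List.mem_cons, List.mem_append, List.not_mem_nil, or_false] at hs
        rcases hs with rfl | hs | rfl | rfl
        · simp
        · exact hlS s hs
        · simp
        · simp
      · simp [hlp, ← mul_assoc, hpow, Nat.bit, pow_succ]

theorem isLittleO_size_natCast :
    (fun n : ℕ => ((3 * Nat.size n : ℕ) : ℝ)) =o[atTop] (fun n : ℕ => (n : ℝ)) := by
  have h1 : (fun n : ℕ => Real.log n) =o[atTop] (fun n : ℕ => (n : ℝ)) :=
    Real.isLittleO_log_id_atTop.comp_tendsto tendsto_natCast_atTop_atTop
  have h2 : (fun _ : ℕ => (1 : ℝ)) =o[atTop] (fun n : ℕ => (n : ℝ)) :=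
    (Asymptotics.isLittleO_const_id_atTop (1 : ℝ)).comp_tendsto tendsto_natCast_atTop_atTop
  have h3 : (fun n : ℕ => 3 / Real.log 2 * Real.log n + 3 * 1) =o[atTop] (fun n : ℕ => (n : ℝ)) :=
    (h1.const_mul_left _).add (h2.const_mul_left _)
  refine (Asymptotics.IsBigO.of_bound 1 ?_).trans_isLittleO h3
  filter_upwards [eventually_ge_atTop 1] with n hn
  have hlog2 : 0 < Real.log 2 := Real.log_pos one_lt_two
  have hle : ((Nat.size n : ℕ) : ℝ) ≤ Real.log n / Real.log 2 + 1 := by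
    obtain ⟨m, hm⟩ : ∃ m, Nat.size n = m + 1 :=
      Nat.exists_eq_succ_of_ne_zero (by rw [Ne, Nat.size_eq_zero]; omega)
    have hpow : 2 ^ m ≤ n := Nat.lt_size.1 (by omega)
    have hpow' : ((2 : ℝ) ^ m) ≤ n := by exact_mod_cast hpow
    have := Real.log_le_log (by positivity) hpow'
    rw [Real.log_pow] at this
    rw [hm]
    push_cast
    have := (le_div_iff₀ hlog2).2 this
    linarith
  have h0 : 0 ≤ Real.log n := Real.log_natCast_nonneg n
  rw [one_mul, Real.norm_of_nonneg (by positivity), Real.norm_of_nonneg (by positivity)]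
  push_cast
  calc (3 : ℝ) * (Nat.size n : ℕ) ≤ 3 * (Real.log n / Real.log 2 + 1) := by gcongr
    _ = _ := by ring

theorem isDistortionElement_of_conj_eq_sq {G : Type*} [Group G] {g h : G}
    (hgh : h * g * h⁻¹ = g ^ 2) : IsDistortionElement g :=
  ⟨{g, h}, by simp, Subgroup.subset_closure (by simp), _, isLittleO_size_natCast,
    isProductOfAtMost_pow_of_conj_eq_sq hgh⟩

/-! ### Calculus of germs through representatives. -/

theorem isRightMap_of_contDiffAt {F : ℝ → ℝ} (hF : ContDiffAt ℝ 1 F 0) (h0 : F 0 = 0)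
    (hpos : ∀ᶠ x in 𝓝[≥] (0 : ℝ), 0 ≤ F x) : IsRightMap 1 F := by
  obtain ⟨u, hu, hC⟩ := hF.contDiffOn (m := 1) le_rfl (by simp)
  have hev : ∀ᶠ x in 𝓝[≥] (0 : ℝ), x ∈ u ∧ 0 ≤ F x :=
    inter_mem (mem_nhdsWithin_of_mem_nhds hu) hpos
  obtain ⟨δ, hδ, hsub⟩ := (mem_nhdsGE_iff_exists_Ico_subset).1 hev
  exact ⟨h0, δ, hδ, fun x hx => (hsub hx).2, hC.mono fun x hx => (hsub hx).1⟩

theorem rightGerm_eq_iff {r : WithTop ℕ∞} {F G : ℝ → ℝ} (hF : IsRightMap r F)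
    (hG : IsRightMap r G) : rightGerm hF = rightGerm hG ↔ ∀ᶠ x in 𝓝[≥] (0 : ℝ), F x = G x := by
  refine (Con.eq (germCon r)).trans ?_
  constructor
  · rintro ⟨η, hη, h⟩
    filter_upwards [Ico_mem_nhdsGE hη] with x hx using h x hx
  · intro h
    obtain ⟨δ, hδ, hsub⟩ := (mem_nhdsGE_iff_exists_Ico_subset).1 h
    exact ⟨δ, hδ, fun x hx => hsub hx⟩

theorem rightGerm_mul {r : WithTop ℕ∞} {F G : ℝ → ℝ} (hF : IsRightMap r F)
    (hG : IsRightMap r G) : rightGerm hF * rightGerm hG = rightGerm (hF.comp hG) := rfl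

theorem isRightMap_id (r : WithTop ℕ∞) : IsRightMap r id := (rightMaps r).one_mem

theorem rightGerm_id (r : WithTop ℕ∞) : rightGerm (isRightMap_id r) = 1 := rfl

theorem IsRightMap.of_le {r s : WithTop ℕ∞} {F : ℝ → ℝ} (hF : IsRightMap r F) (h : s ≤ r) :
    IsRightMap s F := by
  obtain ⟨h0, η, hη, hp, hC⟩ := hF
  exact ⟨h0, η, hη, hp, hC.of_le h⟩

namespace DiffGerm

variable {r s : WithTop ℕ∞}

theorem exists_isGermOf (f : DiffGerm r) : ∃ F, f.IsGermOf F := by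
  obtain ⟨⟨F, hF⟩, h⟩ := Con.mk'_surjective (c := germCon r) (f : (germCon r).Quotient)
  exact ⟨F, hF, h.symm⟩

theorem IsGermOf.ofLE {f : DiffGerm r} {F : ℝ → ℝ} (hf : f.IsGermOf F) (h : s ≤ r) :
    (DiffGerm.ofLE h f).IsGermOf F := by
  obtain ⟨hF, hfF⟩ := hf
  refine ⟨hF.of_le h, ?_⟩
  change ((germCon r).lift _ _) (f : (germCon r).Quotient) = _
  rw [hfF]
  rfl

theorem IsGermOf.mul {f g : DiffGerm r} {F G : ℝ → ℝ} (hf : f.IsGermOf F) (hg : g.IsGermOf G) :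
    (f * g).IsGermOf (F ∘ G) := by
  obtain ⟨hF, hfF⟩ := hf
  obtain ⟨hG, hgG⟩ := hg
  exact ⟨hF.comp hG, by rw [Units.val_mul, hfF, hgG, rightGerm_mul]⟩

theorem isGermOf_one : (1 : DiffGerm r).IsGermOf id := ⟨isRightMap_id r, (rightGerm_id r).symm⟩

theorem IsGermOf.eq_iff {f g : DiffGerm r} {F G : ℝ → ℝ} (hf : f.IsGermOf F)
    (hg : g.IsGermOf G) : f = g ↔ ∀ᶠ x in 𝓝[≥] (0 : ℝ), F x = G x := by
  obtain ⟨hF, hfF⟩ := hf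
  obtain ⟨hG, hgG⟩ := hg
  rw [← rightGerm_eq_iff hF hG, ← hfF, ← hgG, Units.ext_iff]

theorem exists_of_inverse {F G : ℝ → ℝ} (hF : IsRightMap r F) (hG : IsRightMap r G)
    (hFG : ∀ᶠ x in 𝓝[≥] (0 : ℝ), F (G x) = x) (hGF : ∀ᶠ x in 𝓝[≥] (0 : ℝ), G (F x) = x) :
    ∃ f : DiffGerm r, f.IsGermOf F :=
  ⟨⟨rightGerm hF, rightGerm hG,
    by rw [rightGerm_mul, ← rightGerm_id, rightGerm_eq_iff]; exact hFG,
    by rw [rightGerm_mul, ← rightGerm_id, rightGerm_eq_iff]; exact hGF⟩, hF, rfl⟩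

end DiffGerm

/-! ### `C^1` diffeomorphisms up to the endpoint. -/

theorem eventually_nhdsGE_of_nhdsGT {p : ℝ → Prop} (h0 : p 0) (h : ∀ᶠ x in 𝓝[>] (0 : ℝ), p x) :
    ∀ᶠ x in 𝓝[≥] (0 : ℝ), p x := by
  rw [← Ioi_insert, nhdsWithin_insert]
  exact eventually_sup.2 ⟨by simpa using h0, h⟩

/-- A `C^1` function on `(0, δ)` which vanishes at `0` and whose derivative has a positive limit
at `0` is the germ of a `C^1` diffeomorphism. -/
theorem DiffGerm.exists_of_hasDerivAt {p p' : ℝ → ℝ} {δ L : ℝ} (hδ : 0 < δ) (hL : 0 < L)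
    (hp : ∀ x ∈ Ioo 0 δ, HasDerivAt p (p' x) x) (hp' : ContinuousOn p' (Ioo 0 δ))
    (hlim : Tendsto p (𝓝[>] 0) (𝓝 0)) (hlim' : Tendsto p' (𝓝[>] 0) (𝓝 L)) :
    ∃ (φ : DiffGerm 1) (P : ℝ → ℝ), φ.IsGermOf P ∧ P 0 = 0 ∧ ∀ x, 0 < x → P x = p x := by
  -- Extending linearly with slope `L` to the left gives a function that is `C^1` on both sides of
  -- `0`, so the usual inverse function theorem applies.
  set q : ℝ → ℝ := fun x => if x ≤ 0 then L * x else p x with hq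
  set q' : ℝ → ℝ := fun x => if x ≤ 0 then L else p' x with hq'
  have hq_neg : ∀ x ≤ 0, q x = L * x := fun x hx => by simp [hq, hx]
  have hq_pos : ∀ x, 0 < x → q x = p x := fun x hx => by simp [hq, not_le.2 hx]
  have hq'_neg : ∀ x ≤ 0, q' x = L := fun x hx => by simp [hq', hx]
  have hq'_pos : ∀ x, 0 < x → q' x = p' x := fun x hx => by simp [hq', not_le.2 hx]
  have hq0 : q 0 = 0 := by simp [hq]
  have hderiv_pos : ∀ x ∈ Ioo 0 δ, HasDerivAt q (p' x) x := fun x hx =>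
    (hp x hx).congr_of_eventuallyEq ((eventually_gt_nhds hx.1).mono hq_pos)
  have hqGT : Tendsto q (𝓝[>] 0) (𝓝 0) :=
    hlim.congr' (eventually_nhdsWithin_of_forall fun x hx => (hq_pos x hx).symm)
  have hderiv0 : HasDerivAt q L 0 := by
    have hle : HasDerivWithinAt q L (Iic 0) 0 := by
      have : HasDerivWithinAt (fun x : ℝ => L * x) L (Iic 0) 0 := by
        simpa using ((hasDerivAt_id (0 : ℝ)).const_mul L).hasDerivWithinAt
      exact this.congr (fun x hx => hq_neg x hx) (by simp [hq])
    have hge : HasDerivWithinAt q L (Ici 0) 0 := by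
      refine hasDerivWithinAt_Ici_of_tendsto_deriv (s := Ioo 0 δ)
        (fun x hx => (hderiv_pos x hx).differentiableAt.differentiableWithinAt) ?_
        (Ioo_mem_nhdsGT hδ) ?_
      · rw [ContinuousWithinAt, hq0]
        exact hqGT.mono_left (nhdsWithin_mono _ fun x hx => hx.1)
      · refine hlim'.congr' ?_
        filter_upwards [Ioo_mem_nhdsGT hδ] with x hx using (hderiv_pos x hx).deriv.symm
    have := hle.union hge
    rwa [Iic_union_Ici, hasDerivWithinAt_univ] at this
  have hderiv : ∀ x ∈ Iio δ, HasDerivAt q (q' x) x := by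
    intro x hx
    rcases lt_trichotomy x 0 with h | rfl | h
    · rw [hq'_neg x h.le]
      have : HasDerivAt (fun x : ℝ => L * x) L x := by
        simpa using (hasDerivAt_id x).const_mul L
      exact this.congr_of_eventuallyEq ((eventually_lt_nhds h).mono fun y hy => hq_neg y hy.le)
    · rw [hq'_neg 0 le_rfl]
      exact hderiv0
    · rw [hq'_pos x h]
      exact hderiv_pos x ⟨h, hx⟩
  have hcont : ContinuousOn q' (Iio δ) := by
    intro x hx
    refine ContinuousAt.continuousWithinAt ?_
    rcases lt_trichotomy x 0 with h | rfl | h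
    · exact continuousAt_const.congr
        ((eventually_lt_nhds h).mono fun y hy => (hq'_neg y hy.le).symm)
    · refine continuousAt_iff_continuous_left'_right'.2 ⟨?_, ?_⟩
      · rw [ContinuousWithinAt, hq'_neg 0 le_rfl]
        exact tendsto_const_nhds.congr'
          (eventually_nhdsWithin_of_forall fun y hy => (hq'_neg y (le_of_lt hy)).symm)
      · rw [ContinuousWithinAt, hq'_neg 0 le_rfl]
        exact hlim'.congr' (eventually_nhdsWithin_of_forall fun y hy => (hq'_pos y hy).symm)
    · exact (hp'.continuousAt (Ioo_mem_nhds h hx)).congr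
        ((eventually_gt_nhds h).mono fun y hy => (hq'_pos y hy).symm)
  have hC : ContDiffAt ℝ 1 q 0 := by
    refine contDiffAt_one_iff.2 ⟨fun x => ContinuousLinearMap.toSpanSingleton ℝ (q' x), Iio δ,
      Iio_mem_nhds hδ, ?_, fun x hx => (hderiv x hx).hasFDerivAt⟩
    exact (ContinuousLinearMap.toSpanSingletonCLE (𝕜 := ℝ) (E := ℝ)).continuous.comp_continuousOn
      hcont
  have hequiv : HasFDerivAt q
      ((ContinuousLinearEquiv.unitsEquivAut ℝ (Units.mk0 L hL.ne') : ℝ ≃L[ℝ] ℝ) : ℝ →L[ℝ] ℝ) 0 := by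
    refine hderiv0.hasFDerivAt.congr_fderiv ?_
    ext
    simp
  set ψ := hC.localInverse hequiv one_ne_zero with hψ
  have hψC : ContDiffAt ℝ 1 ψ 0 := by
    have := hC.to_localInverse hequiv one_ne_zero
    rwa [hq0] at this
  have hstrict := hC.hasStrictFDerivAt' hequiv one_ne_zero
  have hleft : ∀ᶠ x in 𝓝 (0 : ℝ), ψ (q x) = x := hstrict.eventually_left_inverse
  have hright : ∀ᶠ x in 𝓝 (0 : ℝ), q (ψ x) = x := by
    have := hstrict.eventually_right_inverse
    rwa [hq0] at this
  have hqR : IsRightMap 1 q := by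
    refine isRightMap_of_contDiffAt hC hq0 (eventually_nhdsGE_of_nhdsGT hq0.ge ?_)
    have hslope := hderiv0.tendsto_slope_zero_right
    filter_upwards [hslope.eventually (eventually_gt_nhds hL), self_mem_nhdsWithin] with x hx hx0
    simp only [zero_add, hq0, sub_zero, smul_eq_mul] at hx
    exact (pos_of_mul_pos_right hx (inv_nonneg.2 (le_of_lt hx0))).le
  have hψR : IsRightMap 1 ψ := by
    refine isRightMap_of_contDiffAt hψC ?_ ?_
    · have := hleft.self_of_nhds
      rwa [hq0] at this
    · filter_upwards [mem_nhdsWithin_of_mem_nhds hright, self_mem_nhdsWithin] with x hx hx0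
      -- The linear extension is negative on negative reals, so a preimage of a nonnegative number
      -- cannot be negative.
      by_contra hneg
      push Not at hneg
      have hx' : q (ψ x) = x := hx
      rw [hq_neg _ hneg.le] at hx'
      have : L * ψ x < 0 := mul_neg_of_pos_of_neg hL hneg
      exact absurd hx0 (by simp; linarith)
  obtain ⟨φ, hφ⟩ := DiffGerm.exists_of_inverse hqR hψR (mem_nhdsWithin_of_mem_nhds hright)
    (mem_nhdsWithin_of_mem_nhds hleft)
  exact ⟨φ, q, hφ, hq0, hq_pos⟩

/-! ### Abel's equation near `+∞`. -/

/-- Far out, `Φ y - b * y` is `ε / 2`-Lipschitz by the mean value inequality, and its value at the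
base point is negligible against `y`. This controls `Φ (x ^ (-ℓ)) * x ^ ℓ`, hence the derivative of
the conjugacy at `0`. -/
theorem tendsto_div_id_of_tendsto_hasDerivAt {Φ Φ' : ℝ → ℝ} {b : ℝ}
    (hΦ : ∀ᶠ y in atTop, HasDerivAt Φ (Φ' y) y) (hlim : Tendsto Φ' atTop (𝓝 b)) :
    Tendsto (fun y => Φ y / y) atTop (𝓝 b) := by
  rw [Metric.tendsto_atTop]
  intro ε hε
  obtain ⟨N, hN⟩ := eventually_atTop.1
    ((hΦ.and (Metric.tendsto_nhds.1 hlim (ε / 2) (by positivity))).and (eventually_ge_atTop 1))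
  have hbound : ∀ y, N ≤ y → |(Φ y - b * y) - (Φ N - b * N)| ≤ ε / 2 * (y - N) := by
    intro y hy
    have := (convex_Ici N).norm_image_sub_le_of_norm_hasDerivWithin_le
      (f := fun y => Φ y - b * y) (f' := fun y => Φ' y - b) (C := ε / 2) (x := N) (y := y)
      (fun x hx => by
        simpa using
          ((hN x hx).1.1.fun_sub ((hasDerivAt_id x).const_mul b)).hasDerivWithinAt)
      (fun x hx => by
        have := (hN x hx).1.2
        rw [Real.dist_eq] at this
        simpa using this.le) self_mem_Ici hy
    simpa [Real.norm_eq_abs, abs_of_nonneg (sub_nonneg.2 hy)] using this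
  set K := |Φ N - b * N| with hK
  refine ⟨max N (4 * K / ε + 1), fun y hy => ?_⟩
  have hyN : N ≤ y := (le_max_left _ _).trans hy
  have hyK : 4 * K / ε + 1 ≤ y := (le_max_right _ _).trans hy
  have hy1 : 1 ≤ y := (hN y hyN).2
  have hN1 : 1 ≤ N := (hN N le_rfl).2
  have h1 : |Φ y - b * y| ≤ ε / 2 * (y - N) + K := by
    have := abs_sub_abs_le_abs_sub (Φ y - b * y) (Φ N - b * N)
    linarith [hbound y hyN]
  have h2 : 4 * K < ε * y := by
    have : 4 * K / ε < y := by linarith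
    rw [div_lt_iff₀ hε] at this
    linarith
  rw [Real.dist_eq, show Φ y / y - b = (Φ y - b * y) / y by field_simp, abs_div,
    abs_of_pos (show 0 < y by linarith), div_lt_iff₀ (by linarith)]
  nlinarith

theorem summable_add_natCast_mul_rpow {N d s : ℝ} (hN : 0 < N) (hd : 0 < d) (hs : 1 < s) :
    Summable fun k : ℕ => (N + k * d) ^ (-s) := by
  have h := ((Real.summable_one_div_nat_add_rpow (N / d) s).2 hs).mul_left (d ^ (-s))
  refine h.congr fun k => ?_
  have hpos : 0 < (k : ℝ) + N / d := by positivity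
  rw [abs_of_pos hpos, one_div, ← Real.rpow_neg hpos.le, ← Real.mul_rpow hd.le hpos.le]
  congr 1
  field_simp
  ring

theorem hasDerivAt_iterate_prod {T T' : ℝ → ℝ} {s : Set ℝ} (hs : MapsTo T s s)
    (hT : ∀ y ∈ s, HasDerivAt T (T' y) y) (n : ℕ) {y : ℝ} (hy : y ∈ s) :
    HasDerivAt T^[n] (∏ k ∈ Finset.range n, T' (T^[k] y)) y := by
  induction n with
  | zero => simpa using hasDerivAt_id y
  | succ n ih =>
    rw [Function.iterate_succ', Finset.prod_range_succ, mul_comm]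
    exact (hT _ (hs.iterate n hy)).comp y ih

/-- The `C^1` solution of Abel's equation for a map asymptotic to a translation at `+∞`. -/
theorem exists_abel_function {T T' : ℝ → ℝ} {a s : ℝ} (ha : 0 < a) (hs : 1 < s)
    (hT : ∀ᶠ y in atTop, HasDerivAt T (T' y) y) (hT' : ∀ᶠ y in atTop, ContinuousAt T' y)
    (hlim : Tendsto (fun y => T y - y) atTop (𝓝 a))
    (hO : (fun y => T' y - 1) =O[atTop] fun y => y ^ (-s)) :
    ∃ Φ Φ' : ℝ → ℝ, (∀ᶠ y in atTop, HasDerivAt Φ (Φ' y) y) ∧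
      (∀ᶠ y in atTop, ContinuousAt Φ' y) ∧ Tendsto Φ' atTop (𝓝 a⁻¹) ∧
      ∀ᶠ y in atTop, Φ (T y) = Φ y + 1 := by
  obtain ⟨C, hC⟩ := hO.bound
  obtain ⟨N, hN⟩ := eventually_atTop.1 ((((hT.and hT').and hC).and
    (hlim.eventually (eventually_ge_nhds (half_lt_self ha)))).and (eventually_ge_atTop 1))
  have hN1 : 1 ≤ N := (hN N le_rfl).2
  -- Each step gains at least half of its limit `a`; the orbit therefore escapes linearly and the
  -- errors `e k` are dominated by a summable sequence.
  have hstep : ∀ y ∈ Ioi N, y + a / 2 ≤ T y := fun y hy => by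
    have := (hN y (le_of_lt hy)).1.2
    linarith
  have hmaps : MapsTo T (Ioi N) (Ioi N) := fun y hy => by
    have := hstep y hy
    simp only [mem_Ioi] at hy ⊢
    linarith
  have hiter : ∀ n : ℕ, ∀ y ∈ Ioi N, y + n * (a / 2) ≤ T^[n] y := by
    intro n y hy
    induction n with
    | zero => simp
    | succ n ih =>
      rw [Function.iterate_succ_apply']
      have := hstep _ (hmaps.iterate n hy)
      push_cast
      linarith
  have hderiv : ∀ y ∈ Ioi N, HasDerivAt T (T' y) y := fun y hy => (hN y (le_of_lt hy)).1.1.1.1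
  have hTcont : ContinuousOn T (Ioi N) := fun y hy => (hderiv y hy).continuousAt.continuousWithinAt
  have hT'cont : ContinuousOn T' (Ioi N) :=
    fun y hy => (hN y (le_of_lt hy)).1.1.1.2.continuousWithinAt
  set e : ℕ → ℝ → ℝ := fun k y => T' (T^[k] y) - 1 with he
  have he_cont : ∀ k, ContinuousOn (e k) (Ioi N) := fun k =>
    (hT'cont.comp (fun y hy =>
      (hasDerivAt_iterate_prod hmaps hderiv k hy).continuousAt.continuousWithinAt)
      (hmaps.iterate k)).sub continuousOn_const
  have hC0 : 0 ≤ C := by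
    have h1 := (norm_nonneg _).trans (hN N le_rfl).1.1.2
    rw [Real.norm_of_nonneg (Real.rpow_nonneg (by linarith) _)] at h1
    exact nonneg_of_mul_nonneg_left h1 (Real.rpow_pos_of_pos (by linarith) _)
  set b : ℕ → ℝ := fun k => C * (N + k * (a / 2)) ^ (-s) with hb
  have hb_sum : Summable b :=
    (summable_add_natCast_mul_rpow (by linarith) (by positivity) hs).mul_left C
  have he_bound : ∀ k, ∀ y ∈ Ioi N, ‖e k y‖ ≤ b k := by
    intro k y hy
    have hmem : N < T^[k] y := hmaps.iterate k hy
    have h1 := (hN _ hmem.le).1.1.2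
    have hpos : 0 < N + k * (a / 2) := by positivity
    rw [Real.norm_of_nonneg (Real.rpow_nonneg (by linarith) (-s))] at h1
    refine h1.trans (mul_le_mul_of_nonneg_left ?_ hC0)
    refine Real.rpow_le_rpow_of_nonpos hpos ?_ (by linarith)
    have := hiter k y hy
    simp only [mem_Ioi] at hy
    linarith
  -- The limit of the derivatives of `T^[n]`, by the chain rule.
  set u : ℝ → ℝ := fun y => ∏' k, (1 + e k y) with hu
  have hprod : TendstoLocallyUniformlyOn (fun n y => ∏ k ∈ Finset.range n, (1 + e k y)) u atTop
      (Ioi N) :=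
    (hb_sum.hasProdLocallyUniformlyOn_nat_one_add isOpen_Ioi (Eventually.of_forall he_bound)
      he_cont).tendstoLocallyUniformlyOn_finsetRange
  have hpart_cont : ∀ n, ContinuousOn (fun y => ∏ k ∈ Finset.range n, (1 + e k y)) (Ioi N) :=
    fun n => continuousOn_finsetProd _ fun k _ => continuousOn_const.add (he_cont k)
  have hu_cont : ContinuousOn u (Ioi N) :=
    hprod.continuousOn (Eventually.of_forall hpart_cont).frequently
  have hu_at : ∀ y ∈ Ioi N, ContinuousAt u y := fun y hy => hu_cont.continuousAt (Ioi_mem_nhds hy)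
  have hT_top : Tendsto T atTop atTop := by
    refine tendsto_atTop_mono' _ ?_ tendsto_id
    filter_upwards [eventually_gt_atTop N] with y hy
    have := hstep y hy
    simp only [id]
    linarith
  have he_lim : Tendsto (fun y => T' y - 1) atTop (𝓝 0) :=
    hO.trans_tendsto (tendsto_rpow_neg_atTop (by linarith))
  have hu_lim : Tendsto u atTop (𝓝 1) := by
    have := tendsto_tprod_one_add_of_dominated_convergence (𝓕 := atTop) (f := fun y k => e k y)
      (g := fun _ => (0 : ℝ)) hb_sum (fun k => he_lim.comp (hT_top.iterate k))
      (by filter_upwards [eventually_gt_atTop N] with y hy k using he_bound k y hy)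
    simpa using this
  have hsub : ∀ {x y : ℝ}, x ∈ Ioi N → y ∈ Ioi N → uIcc x y ⊆ Ioi N := fun hx hy =>
    ordConnected_Ioi.uIcc_subset hx hy
  -- The `n`-th partial product integrates over `[y, T y]` to `T (T^[n] y) - T^[n] y`, which tends
  -- to `a`; uniform convergence on the segment passes this to `u`. Dividing a primitive of `u` by
  -- `a` then solves Abel's equation.
  have hincr : ∀ y ∈ Ioi N, ∫ x in y..T y, u x = a := by
    intro y hy
    have hTy := hmaps hy
    have hlim1 := TendstoUniformlyOn.tendsto_intervalIntegral_of_continuousOn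
      (μ := MeasureTheory.volume) (a := y) (b := T y)
      (Eventually.of_forall fun n => (hpart_cont n).mono (hsub hy hTy))
      ((tendstoLocallyUniformlyOn_iff_tendstoUniformlyOn_of_compact isCompact_uIcc).1
        (hprod.mono (hsub hy hTy)))
    have hint : ∀ n, ∫ x in y..T y, ∏ k ∈ Finset.range n, (1 + e k x) =
        T (T^[n] y) - T^[n] y := by
      intro n
      rw [intervalIntegral.integral_eq_sub_of_hasDerivAt (f := T^[n]),
        ← Function.iterate_succ_apply, Function.iterate_succ_apply']
      · intro x hx
        simpa [he] using hasDerivAt_iterate_prod hmaps hderiv n (hsub hy hTy hx)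
      · exact ((hpart_cont n).mono (hsub hy hTy)).intervalIntegrable
    simp only [hint] at hlim1
    have hy_top : Tendsto (fun n => T^[n] y) atTop atTop := by
      refine tendsto_atTop_mono (fun n => hiter n y hy) ?_
      exact tendsto_atTop_add_const_left _ _
        (tendsto_natCast_atTop_atTop.atTop_mul_const (by positivity))
    exact tendsto_nhds_unique hlim1 (hlim.comp hy_top)
  have hmem : N + 1 ∈ Ioi N := by simp
  refine ⟨fun y => a⁻¹ * ∫ x in (N + 1)..y, u x, fun y => a⁻¹ * u y, ?_, ?_, ?_, ?_⟩
  · filter_upwards [eventually_gt_atTop N] with y hy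
    exact (intervalIntegral.integral_hasDerivAt_right
      (hu_cont.mono (hsub hmem hy)).intervalIntegrable
      (hu_cont.stronglyMeasurableAtFilter isOpen_Ioi y hy) (hu_at y hy)).const_mul _
  · filter_upwards [eventually_gt_atTop N] with y hy using continuousAt_const.mul (hu_at y hy)
  · simpa using hu_lim.const_mul a⁻¹
  · filter_upwards [eventually_gt_atTop N] with y hy
    rw [← intervalIntegral.integral_add_adjacent_intervals (b := y)
      (hu_cont.mono (hsub hmem hy)).intervalIntegrable
      (hu_cont.mono (hsub hy (hmaps hy))).intervalIntegrable, hincr y hy]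
    field_simp

/-! ### The model flow and its renormalization by a homothety. -/

/-- The model map `x ↦ x / (1 - s x ^ ℓ) ^ (1 / ℓ)`, which sends `x ^ (-ℓ)` to `x ^ (-ℓ) - s`. -/
noncomputable def rootModel (ℓ : ℕ) (s x : ℝ) : ℝ := x / (1 - s * x ^ ℓ) ^ (1 / (ℓ : ℝ))

theorem eventually_one_sub_mul_pow_pos {ℓ : ℕ} (hℓ : 1 ≤ ℓ) (s : ℝ) :
    ∀ᶠ x in 𝓝 (0 : ℝ), 0 < 1 - s * x ^ ℓ := by
  have hc : ContinuousAt (fun x : ℝ => 1 - s * x ^ ℓ) 0 := by fun_prop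
  refine hc.eventually (eventually_gt_nhds ?_)
  simp [show ℓ ≠ 0 by omega]

theorem isRightMap_rootModel {ℓ : ℕ} (hℓ : 1 ≤ ℓ) (s : ℝ) : IsRightMap 1 (rootModel ℓ s) := by
  have h1 : (1 - s * (0 : ℝ) ^ ℓ) ≠ 0 := by simp [show ℓ ≠ 0 by omega]
  have h1' : (1 - s * (0 : ℝ) ^ ℓ) ^ (1 / (ℓ : ℝ)) ≠ 0 := by simp [show ℓ ≠ 0 by omega]
  refine isRightMap_of_contDiffAt ?_ (by simp [rootModel]) ?_
  · refine contDiffAt_id.div (ContDiffAt.rpow_const_of_ne ?_ h1) h1'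
    fun_prop
  · filter_upwards [mem_nhdsWithin_of_mem_nhds (eventually_one_sub_mul_pow_pos hℓ s),
      self_mem_nhdsWithin] with x hx hx0
    exact div_nonneg hx0 (Real.rpow_nonneg (le_of_lt hx) _)

/-- In the coordinate `x ^ (-ℓ)` this is the addition of translations. -/
theorem rootModel_rootModel {ℓ : ℕ} (hℓ : 1 ≤ ℓ) {s t x : ℝ} (hs : 0 < 1 - s * x ^ ℓ)
    (hst : 0 < 1 - (t + s) * x ^ ℓ) :
    rootModel ℓ t (rootModel ℓ s x) = rootModel ℓ (t + s) x := by
  have hℓ0 : ℓ ≠ 0 := by omega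
  have hpow : (rootModel ℓ s x) ^ ℓ = x ^ ℓ / (1 - s * x ^ ℓ) := by
    rw [rootModel, div_pow, one_div, Real.rpow_inv_natCast_pow hs.le hℓ0]
  have heq : 1 - t * (x ^ ℓ / (1 - s * x ^ ℓ)) = (1 - (t + s) * x ^ ℓ) / (1 - s * x ^ ℓ) := by
    have := hs.ne'
    rw [eq_div_iff this, sub_mul, mul_assoc, div_mul_cancel₀ _ this]
    ring
  rw [rootModel, hpow, heq, Real.div_rpow hst.le hs.le, rootModel, rootModel]
  have := (Real.rpow_pos_of_pos hs (1 / (ℓ : ℝ))).ne'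
  have := (Real.rpow_pos_of_pos hst (1 / (ℓ : ℝ))).ne'
  field_simp

theorem eventually_rootModel_rootModel {ℓ : ℕ} (hℓ : 1 ≤ ℓ) (s t : ℝ) :
    ∀ᶠ x in 𝓝[≥] (0 : ℝ), rootModel ℓ t (rootModel ℓ s x) = rootModel ℓ (t + s) x := by
  refine mem_nhdsWithin_of_mem_nhds ?_
  filter_upwards [eventually_one_sub_mul_pow_pos hℓ s, eventually_one_sub_mul_pow_pos hℓ (t + s)]
    with x hx hx' using rootModel_rootModel hℓ hx hx'

theorem rootModel_zero (ℓ : ℕ) (x : ℝ) : rootModel ℓ 0 x = x := by simp [rootModel]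

theorem DiffGerm.exists_isGermOf_rootModel {ℓ : ℕ} (hℓ : 1 ≤ ℓ) (s : ℝ) :
    ∃ g : DiffGerm 1, g.IsGermOf (rootModel ℓ s) := by
  refine DiffGerm.exists_of_inverse (isRightMap_rootModel hℓ s) (isRightMap_rootModel hℓ (-s)) ?_ ?_
  · filter_upwards [eventually_rootModel_rootModel hℓ (-s) s] with x hx
    rw [hx, add_neg_cancel, rootModel_zero]
  · filter_upwards [eventually_rootModel_rootModel hℓ s (-s)] with x hx
    rw [hx, neg_add_cancel, rootModel_zero]

theorem isRightMap_div {a : ℝ} (ha : 0 < a) : IsRightMap 1 fun x => x / a :=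
  isRightMap_of_contDiffAt (by fun_prop) (by simp)
    (eventually_nhdsWithin_of_forall fun _ hx => div_nonneg hx ha.le)

theorem DiffGerm.exists_isGermOf_div {a : ℝ} (ha : 0 < a) :
    ∃ h : DiffGerm 1, h.IsGermOf fun x => x / a :=
  DiffGerm.exists_of_inverse (isRightMap_div ha) (isRightMap_div (inv_pos.2 ha))
    (Eventually.of_forall fun x => by field_simp) (Eventually.of_forall fun x => by field_simp)

theorem DiffGerm.conj_rootModel_eq_sq {ℓ : ℕ} (hℓ : 1 ≤ ℓ) {s : ℝ} {g h : DiffGerm 1}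
    (hg : g.IsGermOf (rootModel ℓ s))
    (hh : h.IsGermOf fun x : ℝ => x / (2 : ℝ) ^ (1 / (ℓ : ℝ))) :
    h * g * h⁻¹ = g ^ 2 := by
  rw [mul_inv_eq_iff_eq_mul, sq, (hh.mul hg).eq_iff ((hg.mul hg).mul hh)]
  have h2 : (0 : ℝ) < (2 : ℝ) ^ (1 / (ℓ : ℝ)) := by positivity
  obtain ⟨hR, -⟩ := hh
  filter_upwards [hR.tendsto.eventually (eventually_rootModel_rootModel hℓ s s)] with x hx
  simp only [Function.comp_apply] at hx ⊢
  have hpow : (x / (2 : ℝ) ^ (1 / (ℓ : ℝ))) ^ ℓ = x ^ ℓ / 2 := by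
    rw [div_pow, one_div, Real.rpow_inv_natCast_pow zero_le_two (by omega)]
  rw [hx]
  simp only [rootModel]
  rw [hpow, show 1 - (s + s) * (x ^ ℓ / 2) = 1 - s * x ^ ℓ by ring]
  ring

/-! ### Expansions of analytic parabolic germs and of their inverses. -/

theorem IsRightMap.congr {r : WithTop ℕ∞} {F G : ℝ → ℝ} (hF : IsRightMap r F)
    (h : ∀ᶠ x in 𝓝[≥] (0 : ℝ), F x = G x) : IsRightMap r G := by
  obtain ⟨h0, η, hη, hp, hC⟩ := hF
  obtain ⟨δ, hδ, hsub⟩ := (mem_nhdsGE_iff_exists_Ico_subset).1 h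
  have hle : ∀ x ∈ Ico 0 (min δ η), x ∈ Ico 0 δ ∧ x ∈ Ico 0 η := fun x hx =>
    ⟨⟨hx.1, hx.2.trans_le (min_le_left _ _)⟩, ⟨hx.1, hx.2.trans_le (min_le_right _ _)⟩⟩
  refine ⟨?_, min δ η, lt_min hδ hη, fun x hx => ?_, ?_⟩
  · exact (hsub ⟨le_rfl, hδ⟩ : F 0 = G 0).symm.trans h0
  · have : F x = G x := hsub (hle x hx).1
    exact this ▸ hp x (hle x hx).2
  · exact (hC.mono fun x hx => (hle x hx).2).congr fun x hx => (hsub (hle x hx).1).symm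

theorem DiffGerm.IsGermOf.congr {r : WithTop ℕ∞} {f : DiffGerm r} {F G : ℝ → ℝ}
    (hf : f.IsGermOf F) (h : ∀ᶠ x in 𝓝[≥] (0 : ℝ), F x = G x) : f.IsGermOf G := by
  obtain ⟨hF, hfF⟩ := hf
  exact ⟨hF.congr h, by rw [hfF, rightGerm_eq_iff]; exact h⟩

theorem IsRightMap.exists_analyticAt {F : ℝ → ℝ} (hF : IsRightMap ω F) :
    ∃ A : ℝ → ℝ, AnalyticAt ℝ A 0 ∧ ∀ᶠ x in 𝓝[≥] (0 : ℝ), F x = A x := by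
  obtain ⟨h0, η, hη, hp, hC⟩ := hF
  have h0mem : (0 : ℝ) ∈ Ico 0 η := ⟨le_rfl, hη⟩
  obtain ⟨A, hFA, hA⟩ := analyticWithinAt_iff_exists_analyticAt.1 (hC 0 h0mem).analyticWithinAt
  rw [insert_eq_of_mem h0mem, nhdsWithin_Ico_eq_nhdsGE hη] at hFA
  exact ⟨A, hA, hFA⟩

/-- Factor out the order of vanishing `n` of `f - id`, finite because `f ≠ 1`. Fixing `0` rules out
`n = 0` and parabolicity rules out `n = 1`, so `ℓ = n - 1 ≥ 1`. -/
theorem DiffGerm.exists_expansion {f : DiffGerm ω} (hpar : f.IsParabolic) (hne : f ≠ 1) :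
    ∃ (ℓ : ℕ) (k : ℝ → ℝ), 1 ≤ ℓ ∧ AnalyticAt ℝ k 0 ∧ k 0 ≠ 0 ∧
      f.IsGermOf fun x => x + x ^ (ℓ + 1) * k x := by
  obtain ⟨F, hfF, hd⟩ := hpar
  obtain ⟨A, hA, hFA⟩ := hfF.1.exists_analyticAt
  have hF0 : F 0 = 0 := hfF.1.1
  have hA0 : A 0 = 0 := by rw [← hFA.self_of_nhdsWithin self_mem_Ici, hF0]
  have hA1 : HasDerivAt A 1 0 := by
    have h1 : HasDerivWithinAt A 1 (Ici 0) 0 :=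
      hd.congr_of_eventuallyEq (hFA.mono fun x hx => hx.symm) (by rw [hA0, hF0])
    have h2 := hA.differentiableAt.hasDerivAt
    rwa [(uniqueDiffWithinAt_Ici (0 : ℝ)).eq_deriv _ h2.hasDerivWithinAt h1] at h2
  have hsub : AnalyticAt ℝ (fun x => A x - x) 0 := hA.sub analyticAt_id
  obtain ⟨n, k, hk, hk0, hev⟩ := hsub.exists_eventuallyEq_pow_smul_nonzero_iff.2 fun h => hne <| by
    refine (hfF.eq_iff DiffGerm.isGermOf_one).2 ?_
    filter_upwards [hFA, mem_nhdsWithin_of_mem_nhds h] with x hx hx'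
    have : A x - x = 0 := hx'
    rw [hx, id]
    linarith
  simp only [sub_zero, smul_eq_mul] at hev
  have hsub1 : HasDerivAt (fun x => A x - x) 0 0 := by
    simpa using hA1.fun_sub (hasDerivAt_id (0 : ℝ))
  have hn : 2 ≤ n := by
    have hv : 0 = (0 : ℝ) ^ n * k 0 := by simpa [hA0] using hev.self_of_nhds
    have hd' := (hsub1.congr_of_eventuallyEq (hev.mono fun x hx => hx.symm)).unique
      ((hasDerivAt_pow n (0 : ℝ)).mul hk.differentiableAt.hasDerivAt)
    by_contra hlt
    have : n = 0 ∨ n = 1 := by omega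
    rcases this with rfl | rfl
    · simp only [pow_zero, one_mul] at hv
      exact hk0 hv.symm
    · simp only [Nat.cast_one, pow_one, Nat.sub_self, pow_zero, one_mul, zero_mul, add_zero] at hd'
      exact hk0 hd'.symm
  refine ⟨n - 1, k, by omega, hk, hk0, hfF.congr ?_⟩
  filter_upwards [hFA, mem_nhdsWithin_of_mem_nhds hev] with x hx hx'
  rw [show n - 1 + 1 = n by omega, ← hx', hx]
  ring

theorem DiffGerm.isExactlyTangent_of_isGermOf {f : DiffGerm ω} {ℓ : ℕ} {k : ℝ → ℝ}
    (hk : AnalyticAt ℝ k 0) (hk0 : k 0 ≠ 0) (hf : f.IsGermOf fun x => x + x ^ (ℓ + 1) * k x) :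
    f.IsExactlyTangent ℓ (k 0) := by
  obtain ⟨p, hp⟩ := hk
  have hsum := hasFPowerSeriesAt_iff.1 hp
  -- The expansion only involves `m ≥ ℓ + 1`, so the truncated subtraction is harmless.
  refine ⟨hk0, _, hf, fun m => p.coeff (m - (ℓ + 1)), ?_, ?_⟩
  · simpa using hp.coeff_zero 1
  · filter_upwards [mem_nhdsWithin_of_mem_nhds hsum] with x hx
    have hx' : HasSum (fun n => x ^ n • p.coeff n) (k (0 + x)) := hx
    rw [zero_add] at hx'
    have hterm : ∀ n, p.coeff (ℓ + 1 + n - (ℓ + 1)) * x ^ (ℓ + 1 + n) =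
        x ^ (ℓ + 1) * x ^ n • p.coeff n := fun n => by
      rw [Nat.add_sub_cancel_left, smul_eq_mul, pow_add]
      ring
    simp only [hterm, add_sub_cancel_left]
    exact hx'.mul_left (x ^ (ℓ + 1))

/-- In `f ∘ f⁻¹ = id` the terms `j 0 * x ^ (m + 1)` and `k 0 * x ^ (ℓ + 1)` must cancel to leading
order; unequal exponents would force `j 0` or `k 0` to vanish. -/
theorem DiffGerm.expansion_inv {f : DiffGerm ω} {ℓ m : ℕ} {k j : ℝ → ℝ} (hℓ : 1 ≤ ℓ) (hm : 1 ≤ m)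
    (hk : ContinuousAt k 0) (hk0 : k 0 ≠ 0) (hj : ContinuousAt j 0) (hj0 : j 0 ≠ 0)
    (hf : f.IsGermOf fun x => x + x ^ (ℓ + 1) * k x)
    (hf' : f⁻¹.IsGermOf fun x => x + x ^ (m + 1) * j x) : m = ℓ ∧ j 0 = -k 0 := by
  have hm0 : m ≠ 0 := by omega
  have hinv : ∀ᶠ x in 𝓝[>] (0 : ℝ), x ^ m * j x +
      x ^ ℓ * ((1 + x ^ m * j x) ^ (ℓ + 1) * k (x + x ^ (m + 1) * j x)) = 0 := by
    have h := (hf.mul hf').eq_iff DiffGerm.isGermOf_one |>.1 (mul_inv_cancel f)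
    filter_upwards [h.filter_mono (nhdsWithin_mono _ Ioi_subset_Ici_self), self_mem_nhdsWithin]
      with x hx hx0
    have hx0' : x ≠ 0 := ne_of_gt hx0
    simp only [Function.comp_apply, id] at hx
    have hfac : (x + x ^ (m + 1) * j x) ^ (ℓ + 1) =
        x ^ (ℓ + 1) * (1 + x ^ m * j x) ^ (ℓ + 1) := by
      rw [← mul_pow]
      ring
    rw [hfac] at hx
    refine (mul_eq_zero.1 (?_ : x * _ = 0)).resolve_left hx0'
    linear_combination hx
  set K : ℝ → ℝ := fun x => (1 + x ^ m * j x) ^ (ℓ + 1) * k (x + x ^ (m + 1) * j x) with hK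
  have hKlim : Tendsto K (𝓝[>] 0) (𝓝 (k 0)) := by
    have hc : ContinuousAt K 0 := by
      have : ContinuousAt k ((0 : ℝ) + 0 ^ (m + 1) * j 0) := by simpa using hk
      refine ContinuousAt.mul (by fun_prop) (ContinuousAt.comp (g := k)
        (f := fun x => x + x ^ (m + 1) * j x) this (by fun_prop))
    have h0 : K 0 = k 0 := by simp [hK, hm0]
    exact h0 ▸ hc.tendsto.mono_left nhdsWithin_le_nhds
  have hjlim : Tendsto j (𝓝[>] 0) (𝓝 (j 0)) := hj.tendsto.mono_left nhdsWithin_le_nhds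
  have hpow : ∀ d : ℕ, d ≠ 0 → Tendsto (fun x : ℝ => x ^ d) (𝓝[>] 0) (𝓝 0) := fun d hd => by
    have := (continuous_pow (M := ℝ) d).tendsto 0
    rw [zero_pow hd] at this
    exact this.mono_left nhdsWithin_le_nhds
  rcases lt_trichotomy m ℓ with hlt | heq | hlt
  · exfalso
    obtain ⟨d, rfl⟩ := Nat.exists_eq_add_of_lt hlt
    have hz : ∀ᶠ x in 𝓝[>] (0 : ℝ), j x + x ^ (d + 1) * K x = 0 := by
      filter_upwards [hinv, self_mem_nhdsWithin] with x hx hx0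
      refine (mul_eq_zero.1 (?_ : x ^ m * _ = 0)).resolve_left (pow_ne_zero _ (ne_of_gt hx0))
      linear_combination hx
    have := tendsto_nhds_unique (hjlim.add ((hpow (d + 1) (by omega)).mul hKlim))
      (tendsto_const_nhds.congr' (hz.mono fun x hx => hx.symm))
    exact hj0 (by simpa using this)
  · subst heq
    refine ⟨rfl, ?_⟩
    have hz : ∀ᶠ x in 𝓝[>] (0 : ℝ), j x + K x = 0 := by
      filter_upwards [hinv, self_mem_nhdsWithin] with x hx hx0
      refine (mul_eq_zero.1 (?_ : x ^ m * _ = 0)).resolve_left (pow_ne_zero _ (ne_of_gt hx0))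
      linear_combination hx
    have := tendsto_nhds_unique (hjlim.add hKlim)
      (tendsto_const_nhds.congr' (hz.mono fun x hx => hx.symm))
    linarith
  · exfalso
    obtain ⟨d, rfl⟩ := Nat.exists_eq_add_of_lt hlt
    have hz : ∀ᶠ x in 𝓝[>] (0 : ℝ), x ^ (d + 1) * j x + K x = 0 := by
      filter_upwards [hinv, self_mem_nhdsWithin] with x hx hx0
      refine (mul_eq_zero.1 (?_ : x ^ ℓ * _ = 0)).resolve_left (pow_ne_zero _ (ne_of_gt hx0))
      linear_combination hx
    have := tendsto_nhds_unique (((hpow (d + 1) (by omega)).mul hjlim).add hKlim)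
      (tendsto_const_nhds.congr' (hz.mono fun x hx => hx.symm))
    exact hk0 (by simpa using this)

theorem DiffGerm.IsParabolic.inv {r : WithTop ℕ∞} {f : DiffGerm r} (hf : f.IsParabolic)
    (hr : r ≠ 0) : f⁻¹.IsParabolic := by
  obtain ⟨F, hfF, hd⟩ := hf
  obtain ⟨G, hfG⟩ := f⁻¹.exists_isGermOf
  refine ⟨G, hfG, ?_⟩
  obtain ⟨hG0, η, hη, hpos, hC⟩ := id hfG.1
  have h0 : (0 : ℝ) ∈ Ico 0 η := ⟨le_rfl, hη⟩
  have hGd : HasDerivWithinAt G (derivWithin G (Ico 0 η) 0) (Ico 0 η) 0 :=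
    (hC.differentiableOn hr 0 h0).hasDerivWithinAt
  have hcomp := HasDerivWithinAt.comp_of_eq (h₂ := F) 0 hd hGd (fun x hx => hpos x hx) hG0.symm
  have hid : HasDerivWithinAt (F ∘ G) 1 (Ici 0) 0 := by
    have hev := ((hfF.mul hfG).eq_iff DiffGerm.isGermOf_one).1 (mul_inv_cancel f)
    exact (hasDerivWithinAt_id 0 (Ici 0)).congr_of_eventuallyEq hev
      (hev.self_of_nhdsWithin self_mem_Ici)
  have hone := (uniqueDiffWithinAt_Ici (0 : ℝ)).eq_deriv _
    (hcomp.mono_of_mem_nhdsWithin (Ico_mem_nhdsGE hη)) hid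
  rw [one_mul] at hone
  exact (hone ▸ hGd).mono_of_mem_nhdsWithin (Ico_mem_nhdsGE hη)

/-! ### The germ in the coordinate `x ^ (-ℓ)`. -/

theorem exists_one_add_pow_eq (n : ℕ) :
    ∃ P : ℝ → ℝ, Continuous P ∧ ∀ u, (1 + u) ^ n = 1 + n * u + u ^ 2 * P u := by
  induction n with
  | zero => exact ⟨0, continuous_const, by simp⟩
  | succ n ih =>
    obtain ⟨P, hP, h⟩ := ih
    refine ⟨fun u => n + (1 + u) * P u, by fun_prop, fun u => ?_⟩
    rw [pow_succ, h]
    push_cast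
    ring

theorem tendsto_rpow_neg_inv_natCast {ℓ : ℕ} (hℓ : 1 ≤ ℓ) :
    Tendsto (fun y : ℝ => y ^ (-(1 / (ℓ : ℝ)))) atTop (𝓝 0) :=
  tendsto_rpow_neg_atTop (by positivity)

theorem inv_pow_rpow_neg_inv {ℓ : ℕ} (hℓ : 1 ≤ ℓ) {x : ℝ} (hx : 0 < x) :
    ((x ^ ℓ)⁻¹) ^ (-(1 / (ℓ : ℝ))) = x := by
  rw [Real.rpow_neg (by positivity), Real.inv_rpow (by positivity), inv_inv, one_div,
    Real.pow_rpow_inv_natCast hx.le (by omega)]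

/-- The map `x ↦ x + x ^ (ℓ + 1) * k x` in the coordinate `y = x ^ (-ℓ)`. -/
noncomputable def mapAtInfinity (ℓ : ℕ) (k : ℝ → ℝ) (y : ℝ) : ℝ :=
  y * ((1 + k (y ^ (-(1 / (ℓ : ℝ)))) * y⁻¹) ^ ℓ)⁻¹

/-- The derivative of `mapAtInfinity`. -/
noncomputable def derivMapAtInfinity (ℓ : ℕ) (k : ℝ → ℝ) (y : ℝ) : ℝ :=
  (1 + (ℓ + 1 : ℕ) * (k (y ^ (-(1 / (ℓ : ℝ)))) * y⁻¹) +
    deriv k (y ^ (-(1 / (ℓ : ℝ)))) * y ^ (-(1 / (ℓ : ℝ)) - 1)) *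
    ((1 + k (y ^ (-(1 / (ℓ : ℝ)))) * y⁻¹) ^ (ℓ + 1))⁻¹

section

variable {ℓ : ℕ} {k : ℝ → ℝ}

theorem tendsto_one_add_mul_inv (hℓ : 1 ≤ ℓ) (hk : ContinuousAt k 0) :
    Tendsto (fun y : ℝ => 1 + k (y ^ (-(1 / (ℓ : ℝ)))) * y⁻¹) atTop (𝓝 1) := by
  have := ((hk.tendsto.comp (tendsto_rpow_neg_inv_natCast hℓ)).mul
    (tendsto_inv_atTop_zero (𝕜 := ℝ))).const_add 1
  simpa using this

theorem eventually_hasDerivAt_mapAtInfinity (hℓ : 1 ≤ ℓ) (hk : AnalyticAt ℝ k 0) :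
    ∀ᶠ y in atTop, HasDerivAt (mapAtInfinity ℓ k) (derivMapAtInfinity ℓ k y) y := by
  have hx := tendsto_rpow_neg_inv_natCast hℓ
  filter_upwards [(tendsto_one_add_mul_inv hℓ hk.continuousAt).eventually
    (eventually_gt_nhds one_pos), hx.eventually hk.eventually_analyticAt, eventually_gt_atTop 0]
    with y hy hky hy0
  have hxd : HasDerivAt (fun y : ℝ => y ^ (-(1 / (ℓ : ℝ))))
      (-(1 / (ℓ : ℝ)) * y ^ (-(1 / (ℓ : ℝ)) - 1)) y :=
    Real.hasDerivAt_rpow_const (Or.inl hy0.ne')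
  have hu := ((hky.differentiableAt.hasDerivAt.comp y hxd).mul (hasDerivAt_inv hy0.ne')).const_add 1
  have hd := (hasDerivAt_id y).mul ((hu.pow ℓ).inv (pow_ne_zero ℓ hy.ne'))
  refine HasDerivAt.congr_deriv (f := mapAtInfinity ℓ k) hd ?_
  have hℓ0 : (ℓ : ℝ) ≠ 0 := by positivity
  obtain ⟨m, rfl⟩ := Nat.exists_eq_add_of_le' hℓ
  simp only [derivMapAtInfinity, Function.comp_apply, id, Pi.pow_apply, Pi.inv_apply, Pi.mul_apply]
  set X := y ^ (-(1 / ((m + 1 : ℕ) : ℝ)) - 1)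
  set K := k (y ^ (-(1 / ((m + 1 : ℕ) : ℝ))))
  set K' := deriv k (y ^ (-(1 / ((m + 1 : ℕ) : ℝ))))
  set c := ((m + 1 : ℕ) : ℝ) with hc
  have hw : 1 + K * y⁻¹ ≠ 0 := hy.ne'
  rw [show ((m + 1 + 1 : ℕ) : ℝ) = c + 1 by rw [hc]; push_cast; ring]
  -- Eliminating `K` in favour of the nonzero quantity `w` reduces the claim to a polynomial
  -- identity.
  obtain ⟨w, hw'⟩ : ∃ w, w = 1 + K * y⁻¹ := ⟨_, rfl⟩
  have hK : K = (w - 1) * y := by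
    rw [hw']
    field_simp
    ring
  rw [← hw'] at hw ⊢
  rw [Nat.add_sub_cancel, hK]
  field_simp
  ring

theorem eventually_continuousAt_derivMapAtInfinity (hℓ : 1 ≤ ℓ) (hk : AnalyticAt ℝ k 0) :
    ∀ᶠ y in atTop, ContinuousAt (derivMapAtInfinity ℓ k) y := by
  have hx := tendsto_rpow_neg_inv_natCast hℓ
  filter_upwards [(tendsto_one_add_mul_inv hℓ hk.continuousAt).eventually
    (eventually_gt_nhds one_pos), hx.eventually hk.eventually_analyticAt, eventually_gt_atTop 0]
    with y hy hky hy0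
  have hxc : ∀ s : ℝ, ContinuousAt (fun y : ℝ => y ^ s) y := fun s =>
    Real.continuousAt_rpow_const _ _ (Or.inl hy0.ne')
  have h1 : ContinuousAt (fun y : ℝ => k (y ^ (-(1 / (ℓ : ℝ))))) y :=
    hky.continuousAt.comp (f := fun y : ℝ => y ^ (-(1 / (ℓ : ℝ)))) (hxc _)
  have h2 : ContinuousAt (fun y : ℝ => deriv k (y ^ (-(1 / (ℓ : ℝ))))) y :=
    hky.deriv.continuousAt.comp (f := fun y : ℝ => y ^ (-(1 / (ℓ : ℝ)))) (hxc _)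
  have h3 := h1.mul (continuousAt_inv₀ hy0.ne')
  exact ((continuousAt_const.add (continuousAt_const.mul h3)).add (h2.mul (hxc _))).mul
    (((continuousAt_const.add h3).pow _).inv₀ (pow_ne_zero _ hy.ne'))

theorem tendsto_mapAtInfinity_sub (hℓ : 1 ≤ ℓ) (hk : ContinuousAt k 0) :
    Tendsto (fun y => mapAtInfinity ℓ k y - y) atTop (𝓝 (-(ℓ * k 0))) := by
  obtain ⟨P, hP, hPeq⟩ := exists_one_add_pow_eq ℓ
  have hw := tendsto_one_add_mul_inv hℓ hk
  have hkx := hk.tendsto.comp (tendsto_rpow_neg_inv_natCast hℓ)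
  have hu : Tendsto (fun y : ℝ => k (y ^ (-(1 / (ℓ : ℝ)))) * y⁻¹) atTop (𝓝 0) := by
    simpa using hw.sub_const 1
  have hlim := (((hkx.const_mul (ℓ : ℝ)).add
    (((hkx.pow 2).mul tendsto_inv_atTop_zero).mul ((hP.tendsto 0).comp hu))).neg).mul
    ((hw.pow ℓ).inv₀ (by simp))
  simp only [mul_zero, zero_mul, add_zero, one_pow, inv_one, mul_one] at hlim
  refine hlim.congr' ?_
  filter_upwards [hw.eventually (eventually_gt_nhds one_pos), eventually_gt_atTop 0] with y hy hy0
  have hpow := hPeq (k (y ^ (-(1 / (ℓ : ℝ)))) * y⁻¹)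
  have hne := pow_ne_zero ℓ hy.ne'
  simp only [mapAtInfinity, Function.comp_apply]
  set K := k (y ^ (-(1 / (ℓ : ℝ))))
  set Q := P (K * y⁻¹)
  set W := (1 + K * y⁻¹) ^ ℓ
  rw [mul_inv_eq_iff_eq_mul₀ hne, sub_mul, inv_mul_cancel_right₀ hne, hpow]
  field_simp
  ring

/-- With `u = k(x) / y`, the term `(ℓ + 1) * u` of the numerator cancels the linear term of `(1 + u)
^ (ℓ + 1)`. There remain `O(y⁻²)` and the `deriv k` term, of order `y ^ (-1 - 1/ℓ)`. Without the
cancellation the bound would be `O(y⁻¹)`, not summable along orbits. -/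
theorem isBigO_derivMapAtInfinity_sub_one (hℓ : 1 ≤ ℓ) (hk : AnalyticAt ℝ k 0) :
    (fun y => derivMapAtInfinity ℓ k y - 1) =O[atTop] fun y => y ^ (-(1 / (ℓ : ℝ) + 1)) := by
  obtain ⟨P, hP, hPeq⟩ := exists_one_add_pow_eq (ℓ + 1)
  have hw := tendsto_one_add_mul_inv hℓ hk.continuousAt
  have hx := tendsto_rpow_neg_inv_natCast hℓ
  have hkx := hk.continuousAt.tendsto.comp hx
  have hkx' := hk.deriv.continuousAt.tendsto.comp hx
  have hu : Tendsto (fun y : ℝ => k (y ^ (-(1 / (ℓ : ℝ)))) * y⁻¹) atTop (𝓝 0) := by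
    simpa using hw.sub_const 1
  have h1 : (fun y : ℝ => deriv k (y ^ (-(1 / (ℓ : ℝ)))) * y ^ (-(1 / (ℓ : ℝ)) - 1))
      =O[atTop] fun y => y ^ (-(1 / (ℓ : ℝ) + 1)) := by
    have := (hkx'.isBigO_one ℝ).mul (Asymptotics.isBigO_refl
      (fun y : ℝ => y ^ (-(1 / (ℓ : ℝ)) - 1)) atTop)
    simpa [neg_add, sub_eq_add_neg, add_comm] using this
  have h2 : (fun y : ℝ => (y⁻¹) ^ 2) =O[atTop] fun y => y ^ (-(1 / (ℓ : ℝ) + 1)) := by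
    refine Asymptotics.IsBigO.of_bound 1 ?_
    filter_upwards [eventually_ge_atTop 1] with y hy
    have hy0 : 0 < y := by linarith
    rw [one_mul, Real.norm_of_nonneg (by positivity), Real.norm_of_nonneg (by positivity),
      show (y⁻¹) ^ 2 = y ^ (-2 : ℝ) by rw [Real.rpow_neg hy0.le, inv_pow]; norm_cast]
    refine Real.rpow_le_rpow_of_exponent_le hy ?_
    have : 1 / (ℓ : ℝ) ≤ 1 := by
      rw [div_le_one (by positivity)]
      exact_mod_cast hℓ
    linarith
  have h3 := (((hkx.pow 2).mul ((hP.tendsto 0).comp hu)).isBigO_one ℝ).mul h2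
  have h4 := (h1.sub (by simpa only [one_mul] using h3)).mul
    (((hw.pow (ℓ + 1)).inv₀ (by simp)).isBigO_one ℝ)
  simp only [mul_one] at h4
  refine h4.congr' ?_ EventuallyEq.rfl
  filter_upwards [hw.eventually (eventually_gt_nhds one_pos)] with y hy
  have hpow := hPeq (k (y ^ (-(1 / (ℓ : ℝ)))) * y⁻¹)
  have hne := pow_ne_zero (ℓ + 1) hy.ne'
  simp only [derivMapAtInfinity, Function.comp_apply]
  rw [eq_comm, sub_eq_iff_eq_add, mul_inv_eq_iff_eq_mul₀ hne, add_mul,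
    inv_mul_cancel_right₀ hne, hpow]
  ring

end

/-! ### The conjugacy and the conclusion. -/

theorem DiffGerm.exists_conj_rootModel {f : DiffGerm 1} {ℓ : ℕ} {k : ℝ → ℝ} (hℓ : 1 ≤ ℓ)
    (hk : AnalyticAt ℝ k 0) (hk0 : k 0 < 0) (hf : f.IsGermOf fun x => x + x ^ (ℓ + 1) * k x)
    {g : DiffGerm 1} (hg : g.IsGermOf (rootModel ℓ (-1))) :
    ∃ φ : DiffGerm 1, φ * f * φ⁻¹ = g := by
  have hℓ0 : ℓ ≠ 0 := by omega
  have hℓR : (0 : ℝ) < ℓ := by positivity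
  set a : ℝ := -(ℓ * k 0) with ha_def
  have ha : 0 < a := by
    rw [ha_def, neg_pos]
    exact mul_neg_of_pos_of_neg hℓR hk0
  obtain ⟨Φ, Φ', hΦ, hΦ', hlim, habel⟩ := exists_abel_function ha
    (lt_add_of_pos_left 1 (show 0 < 1 / (ℓ : ℝ) by positivity))
    (eventually_hasDerivAt_mapAtInfinity hℓ hk) (eventually_continuousAt_derivMapAtInfinity hℓ hk)
    (tendsto_mapAtInfinity_sub hℓ hk.continuousAt) (isBigO_derivMapAtInfinity_sub_one hℓ hk)
  have hdiv := tendsto_div_id_of_tendsto_hasDerivAt hΦ hlim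
  have hΦtop : Tendsto Φ atTop atTop := by
    refine (hdiv.pos_mul_atTop (inv_pos.2 ha) tendsto_id).congr' ?_
    filter_upwards [eventually_ne_atTop 0] with y hy using div_mul_cancel₀ _ hy
  have hy_top : Tendsto (fun x : ℝ => (x ^ ℓ)⁻¹) (𝓝[>] 0) atTop := by
    refine tendsto_inv_nhdsGT_zero.comp (tendsto_nhdsWithin_iff.2 ⟨?_, ?_⟩)
    · have := (continuous_pow (M := ℝ) ℓ).tendsto 0
      rw [zero_pow hℓ0] at this
      exact this.mono_left nhdsWithin_le_nhds
    · exact eventually_nhdsWithin_of_forall fun x hx => mem_Ioi.2 (pow_pos (mem_Ioi.1 hx) ℓ)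
  -- This is `Φ` brought back to the coordinate `x`. Its derivative is written through `Φ'` and `Φ y
  -- / y`, which both tend to `a⁻¹`; the limit at `0` is `a ^ (1 / ℓ) > 0`.
  set p : ℝ → ℝ := fun x => Φ ((x ^ ℓ)⁻¹) ^ (-(1 / (ℓ : ℝ))) with hp
  set p' : ℝ → ℝ := fun x => Φ' ((x ^ ℓ)⁻¹) *
    (Φ ((x ^ ℓ)⁻¹) / (x ^ ℓ)⁻¹) ^ (-(1 / (ℓ : ℝ)) - 1) with hp'
  have hgood : ∀ᶠ x in 𝓝[>] (0 : ℝ), HasDerivAt Φ (Φ' (x ^ ℓ)⁻¹) (x ^ ℓ)⁻¹ ∧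
      ContinuousAt Φ' (x ^ ℓ)⁻¹ ∧ 0 < Φ (x ^ ℓ)⁻¹ :=
    (hy_top.eventually hΦ).and ((hy_top.eventually hΦ').and
      (hy_top.eventually (hΦtop.eventually_gt_atTop 0)))
  obtain ⟨δ, hδ, hsub⟩ := (mem_nhdsGT_iff_exists_Ioo_subset).1 hgood
  have hpd : ∀ x ∈ Ioo 0 δ, HasDerivAt p (p' x) x := by
    intro x hx
    obtain ⟨hd, -, hpos⟩ := hsub hx
    have hx0 : 0 < x := hx.1
    have hyd := (hasDerivAt_pow ℓ x).inv (pow_ne_zero ℓ hx0.ne')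
    have h := (hd.comp x hyd).rpow_const (p := -(1 / (ℓ : ℝ))) (Or.inl hpos.ne')
    refine HasDerivAt.congr_deriv (f := p) h ?_
    simp only [hp', Function.comp_apply, Pi.inv_apply]
    have hr : ((x ^ ℓ)⁻¹ : ℝ) ^ (-(1 / (ℓ : ℝ)) - 1) = x * x ^ ℓ := by
      rw [Real.rpow_sub_one (by positivity), inv_pow_rpow_neg_inv hℓ hx0]
      field_simp
    rw [Real.div_rpow hpos.le (by positivity), hr]
    obtain ⟨m, rfl⟩ := Nat.exists_eq_add_of_le' hℓ
    rw [Nat.add_sub_cancel]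
    field_simp
    ring
  have hp'c : ContinuousOn p' (Ioo 0 δ) := by
    intro x hx
    obtain ⟨hd, hc, hpos⟩ := hsub hx
    have hx0 : 0 < x := hx.1
    have hyc : ContinuousAt (fun x : ℝ => (x ^ ℓ)⁻¹) x :=
      (continuousAt_id.pow ℓ).inv₀ (pow_ne_zero ℓ hx0.ne')
    have h1 : ContinuousAt (fun x : ℝ => Φ' ((x ^ ℓ)⁻¹)) x :=
      ContinuousAt.comp (f := fun x : ℝ => (x ^ ℓ)⁻¹) hc hyc
    have h2 : ContinuousAt (fun x : ℝ => Φ ((x ^ ℓ)⁻¹)) x :=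
      ContinuousAt.comp (f := fun x : ℝ => (x ^ ℓ)⁻¹) hd.continuousAt hyc
    have hyne : ((x ^ ℓ)⁻¹ : ℝ) ≠ 0 := by positivity
    exact (h1.mul ((h2.div hyc hyne).rpow_const
      (Or.inl (div_ne_zero hpos.ne' hyne)))).continuousWithinAt
  have hp0 : Tendsto p (𝓝[>] 0) (𝓝 0) :=
    (tendsto_rpow_neg_inv_natCast hℓ).comp (hΦtop.comp hy_top)
  have hp'0 : Tendsto p' (𝓝[>] 0) (𝓝 (a⁻¹ * a⁻¹ ^ (-(1 / (ℓ : ℝ)) - 1))) :=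
    (hlim.comp hy_top).mul
      ((hdiv.comp hy_top).rpow_const (Or.inl (inv_pos.2 ha).ne'))
  obtain ⟨φ, P, hφ, hP0, hP⟩ := DiffGerm.exists_of_hasDerivAt hδ (by positivity) hpd hp'c hp0 hp'0
  refine ⟨φ, ?_⟩
  rw [mul_inv_eq_iff_eq_mul, (hφ.mul hf).eq_iff (hg.mul hφ)]
  refine eventually_nhdsGE_of_nhdsGT (by simp [hP0, rootModel]) ?_
  have hw : ∀ᶠ x in 𝓝[>] (0 : ℝ), 0 < 1 + k x * x ^ ℓ := by
    have hc : ContinuousAt (fun x => 1 + k x * x ^ ℓ) 0 :=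
      continuousAt_const.add (hk.continuousAt.mul (by fun_prop))
    exact (hc.eventually (eventually_gt_nhds (by simp [hℓ0]))).filter_mono nhdsWithin_le_nhds
  filter_upwards [hgood, hw, hy_top.eventually habel, self_mem_nhdsWithin]
    with x hx hw hab hx0
  have hpos : 0 < Φ (x ^ ℓ)⁻¹ := hx.2.2
  have hx0 : 0 < x := hx0
  have hF : x + x ^ (ℓ + 1) * k x = x * (1 + k x * x ^ ℓ) := by ring
  have hFpos : 0 < x * (1 + k x * x ^ ℓ) := mul_pos hx0 hw
  have hT : ((x * (1 + k x * x ^ ℓ)) ^ ℓ)⁻¹ = mapAtInfinity ℓ k ((x ^ ℓ)⁻¹) := by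
    rw [mapAtInfinity, inv_pow_rpow_neg_inv hℓ hx0, inv_inv, mul_pow, mul_inv]
  simp only [Function.comp_apply]
  rw [hF, hP _ hFpos, hP _ hx0]
  simp only [hp]
  rw [hT, hab, rootModel]
  set Y := Φ (x ^ ℓ)⁻¹
  have hpow : (Y ^ (-(1 / (ℓ : ℝ)))) ^ ℓ = Y⁻¹ := by
    rw [Real.rpow_neg hpos.le, inv_pow, one_div, Real.rpow_inv_natCast_pow hpos.le hℓ0]
  rw [hpow, show 1 - -1 * Y⁻¹ = (Y + 1) / Y by field_simp; ring,
    Real.div_rpow (by linarith) hpos.le, Real.rpow_neg (by linarith), Real.rpow_neg hpos.le]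
  have := (Real.rpow_pos_of_pos hpos (1 / (ℓ : ℝ))).ne'
  field_simp

theorem mainTheorem10 (f : DiffGerm ω) (hpar : f.IsParabolic) (hne : f ≠ 1) :
    IsDistortionElement (DiffGerm.ofLE (s := 1) le_top f) ∧
    ∃ (ℓ : ℕ) (c : ℝ), 1 ≤ ℓ ∧ f.IsExactlyTangent ℓ c ∧
      ∃ φ g h : DiffGerm 1,
        g.IsGermOf (fun x : ℝ => x / (1 - Real.sign c * x ^ ℓ) ^ (1 / (ℓ : ℝ))) ∧
        h.IsGermOf (fun x : ℝ => x / (2 : ℝ) ^ (1 / (ℓ : ℝ))) ∧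
        φ * DiffGerm.ofLE (s := 1) le_top f * φ⁻¹ = g ∧
        h * g * h⁻¹ = g ^ 2 := by
  obtain ⟨ℓ, k, hℓ, hk, hk0, hf⟩ := DiffGerm.exists_expansion hpar hne
  have hconj : ∃ φ g : DiffGerm 1, g.IsGermOf (rootModel ℓ (Real.sign (k 0))) ∧
      φ * DiffGerm.ofLE (s := 1) le_top f * φ⁻¹ = g := by
    rcases hk0.lt_or_gt with hneg | hpos
    · obtain ⟨g, hg⟩ := DiffGerm.exists_isGermOf_rootModel hℓ (-1)
      obtain ⟨φ, hφ⟩ := DiffGerm.exists_conj_rootModel hℓ hk hneg (hf.ofLE le_top) hg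
      exact ⟨φ, g, by rwa [Real.sign_of_neg hneg], hφ⟩
    -- Here `f` moves points away from `0`, so `f⁻¹` is conjugated to the model with parameter `-1`,
    -- whose inverse is the model with parameter `1`.
    · obtain ⟨m, j, hm, hj, hj0, hf'⟩ := DiffGerm.exists_expansion (hpar.inv (by simp)) (inv_ne_one.2 hne)
      obtain ⟨rfl, hjk⟩ := DiffGerm.expansion_inv hℓ hm hk.continuousAt hk0 hj.continuousAt hj0
        hf hf'
      obtain ⟨g, hg⟩ := DiffGerm.exists_isGermOf_rootModel hℓ (-1)
      obtain ⟨g₁, hg₁⟩ := DiffGerm.exists_isGermOf_rootModel hℓ 1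
      have hgg₁ : g * g₁ = 1 := by
        rw [(hg.mul hg₁).eq_iff DiffGerm.isGermOf_one]
        filter_upwards [eventually_rootModel_rootModel hm 1 (-1)] with x hx
        simpa [rootModel_zero] using hx
      obtain ⟨φ, hφ⟩ := DiffGerm.exists_conj_rootModel hℓ hj (by linarith) (hf'.ofLE le_top) hg
      refine ⟨φ, g₁, by rwa [Real.sign_of_pos hpos], ?_⟩
      rw [← inv_eq_of_mul_eq_one_right hgg₁, ← hφ, map_inv]
      group
  obtain ⟨φ, g, hg, hφ⟩ := hconj
  obtain ⟨h, hh⟩ := DiffGerm.exists_isGermOf_div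
    (show (0 : ℝ) < (2 : ℝ) ^ (1 / (ℓ : ℝ)) by positivity)
  have hgh := DiffGerm.conj_rootModel_eq_sq hℓ hg hh
  refine ⟨?_, ℓ, k 0, hℓ, DiffGerm.isExactlyTangent_of_isGermOf hk hk0 hf, φ, g, h, hg, hh, hφ,
    hgh⟩
  -- The doubling relation is transported from `g` to `f` by `φ`.
  refine isDistortionElement_of_conj_eq_sq (h := φ⁻¹ * h * φ) ?_
  have hfg : DiffGerm.ofLE (s := 1) le_top f = φ⁻¹ * g * φ := by
    rw [← hφ]
    group
  rw [hfg]
  calc φ⁻¹ * h * φ * (φ⁻¹ * g * φ) * (φ⁻¹ * h * φ)⁻¹ = φ⁻¹ * (h * g * h⁻¹) * φ := by group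
    _ = (φ⁻¹ * g * φ) ^ 2 := by
      rw [hgh, sq, sq]
      group
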